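/- Theorem. Let $p$ be a prime, let $S$ be a regular domain of characteristic $p$ that is $F$-finite (that is, $S$ is finitely generated as a module over itself via the Frobenius map $s\mapsto s^p$), and let $R\subseteq S$ be an extension of Noetherian rings such that $R$ is a direct summand of $S$, i.e. there is an $R$-linear map $\beta:S\to R$ with $\beta(r)=r$ for all $r\in R$. Let $D_R=\bigcup_{m\ge 0}D_R^m\subseteq\operatorname{Hom}_{\mathbb Z}(R,R)$ be the ring of differential operators of $R$, where $D_R^0$ consists of the multiplications by elements of $R$ and $\delta\in D_R^{m}$ for $m\ge 1$ if and only if $[\delta,r]=\delta r-r\delta\in D_R^{m-1}$ for every $r\in R$. For $f\in R$, let $D_R$ act on the localization $R_f$ by the rules $$\delta\cdot\frac{v}{f^t}=\frac{\delta(v)}{f^t}\quad(\delta\in D_R^0),\qquad \delta\cdot\frac{v}{f^t}=\frac{\delta(v)-[\delta,f^t]\cdot\frac{v}{f^t}}{f^t}\quad(\delta\in D_R^{m},\ m\ge 1).$$ Then, for every $f\in R$, the $D_R$-module $R_f$ is generated by $\frac1f$, i.e. $R_f=D_R\cdot\frac1f$. -/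

import Mathlib

namespace DSummand

section DiffOp

variable {R : Type*} [CommRing R]
variable {M N P : Type*} [AddCommGroup M] [Module R M] [AddCommGroup N] [Module R N]
  [AddCommGroup P] [Module R P]

/-- Multiplication by `r : R` on an `R`-module, as an additive map. -/
def mulBy (M : Type*) [AddCommGroup M] [Module R M] (r : R) : M →ₗ[ℤ] M :=
  (LinearMap.lsmul R M r).restrictScalars ℤ

@[simp] theorem mulBy_apply (r : R) (m : M) : mulBy M r m = r • m := rfl

/-- The commutator `[D, r] = D ∘ r - r ∘ D` of an additive map between `R`-modules with the
multiplication by `r : R`. -/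
def commR (D : M →ₗ[ℤ] N) (r : R) : M →ₗ[ℤ] N :=
  D ∘ₗ mulBy M r - mulBy N r ∘ₗ D

@[simp] theorem commR_apply (D : M →ₗ[ℤ] N) (r : R) (m : M) :
    commR D r m = D (r • m) - r • D m := rfl

/-- `IsDiffOp R n D`: the additive map `D : M → N` between `R`-modules is a differential operator
of order at most `n` (Grothendieck). Order zero means `R`-linear; for `M = N = R` these are the
multiplications by the elements of `R`, see `isDiffOp_zero_iff`. -/
def IsDiffOp (R : Type*) [CommRing R] {M N : Type*} [AddCommGroup M] [Module R M]
    [AddCommGroup N] [Module R N] : ℕ → (M →ₗ[ℤ] N) → Prop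
  | 0, D => ∀ (r : R) (m : M), D (r • m) = r • D m
  | n + 1, D => ∀ r : R, IsDiffOp R n (commR D r)

theorem isDiffOp_zero_iff (D : Module.End ℤ R) :
    IsDiffOp R 0 D ↔ ∃ a : R, ∀ x : R, D x = a * x := by
  constructor
  · intro h
    refine ⟨D 1, fun x => ?_⟩
    have := h x 1
    simp only [smul_eq_mul, mul_one] at this
    rw [this, mul_comm]
  · rintro ⟨a, ha⟩ r m
    simp only [ha, smul_eq_mul]
    ring

theorem isDiffOp_succ_iff (n : ℕ) (D : Module.End ℤ R) :
    IsDiffOp R (n + 1) D ↔ ∀ r : R, IsDiffOp R n (D * mulBy R r - mulBy R r * D) :=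
  Iff.rfl

theorem IsDiffOp.zero_map (n : ℕ) : IsDiffOp R n (0 : M →ₗ[ℤ] N) := by
  induction n with
  | zero => intro r m; simp
  | succ n ih =>
    intro r
    have : commR (0 : M →ₗ[ℤ] N) r = 0 := by ext m; simp
    rw [this]; exact ih

theorem IsDiffOp.commR_eq_zero {D : M →ₗ[ℤ] N} (h : IsDiffOp R 0 D) (r : R) :
    commR D r = 0 := by
  ext m; simp [h r m]

theorem IsDiffOp.succ {n : ℕ} {D : M →ₗ[ℤ] N} (h : IsDiffOp R n D) : IsDiffOp R (n + 1) D := by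
  induction n generalizing D with
  | zero => intro r; rw [h.commR_eq_zero r]; exact IsDiffOp.zero_map 0
  | succ n ih => intro r; exact ih (h r)

theorem IsDiffOp.mono {m n : ℕ} (hmn : m ≤ n) {D : M →ₗ[ℤ] N} (h : IsDiffOp R m D) :
    IsDiffOp R n D := by
  induction hmn with
  | refl => exact h
  | step _ ih => exact ih.succ

theorem IsDiffOp.add {n : ℕ} {D E : M →ₗ[ℤ] N} (hD : IsDiffOp R n D) (hE : IsDiffOp R n E) :
    IsDiffOp R n (D + E) := by
  induction n generalizing D E with
  | zero => intro r m; simp [hD r m, hE r m]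
  | succ n ih =>
    intro r
    have : commR (D + E) r = commR D r + commR E r := by
      ext m; simp only [commR_apply, LinearMap.add_apply, smul_add]; abel
    rw [this]; exact ih (hD r) (hE r)

theorem IsDiffOp.neg {n : ℕ} {D : M →ₗ[ℤ] N} (hD : IsDiffOp R n D) : IsDiffOp R n (-D) := by
  induction n generalizing D with
  | zero => intro r m; simp [hD r m]
  | succ n ih =>
    intro r
    have : commR (-D) r = -commR D r := by
      ext m; simp only [commR_apply, LinearMap.neg_apply, smul_neg]; abel
    rw [this]; exact ih (hD r)

theorem IsDiffOp.comp {m n : ℕ} {D : N →ₗ[ℤ] P} {E : M →ₗ[ℤ] N} (hD : IsDiffOp R m D)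
    (hE : IsDiffOp R n E) : IsDiffOp R (m + n) (D ∘ₗ E) := by
  have key : ∀ (D : N →ₗ[ℤ] P) (E : M →ₗ[ℤ] N) (r : R),
      commR (D ∘ₗ E) r = D ∘ₗ commR E r + commR D r ∘ₗ E := by
    intro D E r; ext x; simp
  induction m generalizing n D E with
  | zero =>
    rw [Nat.zero_add]
    induction n generalizing E with
    | zero => intro r x; simp [hE r x, hD r (E x)]
    | succ n ihn =>
      intro r
      rw [key, hD.commR_eq_zero r, LinearMap.zero_comp, add_zero]
      exact ihn (hE r)
  | succ m ihm =>
    induction n generalizing E with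
    | zero =>
      intro r
      rw [key, hE.commR_eq_zero r, LinearMap.comp_zero, zero_add]
      exact ihm (hD r) hE
    | succ n ihn =>
      intro r
      rw [key]
      refine IsDiffOp.add (ihn (hE r)) ?_
      exact (ihm (hD r) hE).mono (by change m + (n + 1) ≤ (m + 1) + n; omega)

/-- The ring `D_R` of differential operators of `R`, a subring of `Hom_ℤ(R, R)`. -/
def diffOp (R : Type*) [CommRing R] : Subring (Module.End ℤ R) where
  carrier := {D | ∃ n : ℕ, IsDiffOp R n D}
  mul_mem' := by
    rintro D E ⟨m, hm⟩ ⟨n, hn⟩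
    exact ⟨m + n, hm.comp hn⟩
  one_mem' := ⟨0, fun _ _ => rfl⟩
  add_mem' := by
    rintro D E ⟨m, hm⟩ ⟨n, hn⟩
    exact ⟨max m n, (hm.mono (le_max_left m n)).add (hn.mono (le_max_right m n))⟩
  zero_mem' := ⟨0, IsDiffOp.zero_map 0⟩
  neg_mem' := by
    rintro D ⟨m, hm⟩
    exact ⟨m, hm.neg⟩

theorem mem_diffOp {D : Module.End ℤ R} : D ∈ diffOp R ↔ ∃ n : ℕ, IsDiffOp R n D := Iff.rfl

end DiffOp

section Extension

variable {R : Type*} [CommRing R] {W : Submonoid R}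

theorem IsDiffOp.mulLeft {M : Type*} [AddCommGroup M] [Module R M] {n : ℕ}
    {D : M →ₗ[ℤ] Localization W} (hD : IsDiffOp R n D) (a : Localization W) :
    IsDiffOp R n (LinearMap.mulLeft ℤ a ∘ₗ D) := by
  have h0 : IsDiffOp R 0 (LinearMap.mulLeft ℤ a) := fun r m => by simp
  simpa using h0.comp hD

/-- The localization map `R → W⁻¹R` as an additive map. -/
def locMap (W : Submonoid R) : R →ₗ[ℤ] Localization W :=
  (Algebra.linearMap R (Localization W)).restrictScalars ℤ

@[simp] theorem locMap_apply (x : R) : locMap W x = algebraMap R (Localization W) x := rfl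

theorem locMap_isDiffOp : IsDiffOp R 0 (locMap W) := fun r m => by
  simp [Algebra.smul_def]

theorem smul_mk_one (g : W) (a : Localization W) :
    Localization.mk 1 g * ((g : R) • a) = a := by
  rw [Algebra.smul_def, ← mul_assoc, ← Localization.mk_one_eq_algebraMap, Localization.mk_mul,
    one_mul, mul_one, Localization.mk_self, one_mul]

theorem IsDiffOp.eq_zero {M : Type*} [AddCommGroup M] [Module R M] {n : ℕ}
    {D : M →ₗ[ℤ] Localization W} (hD : IsDiffOp R n D) (g : W)
    (h : ∀ m, D ((g : R) • m) = 0) : D = 0 := by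
  have base : ∀ D : M →ₗ[ℤ] Localization W, IsDiffOp R 0 D →
      (∀ m, D ((g : R) • m) = 0) → D = 0 := by
    intro D hD h
    ext m
    have h1 := h m
    rw [hD] at h1
    rw [← smul_mk_one g (D m), h1]; simp
  induction n generalizing D with
  | zero => exact base D hD h
  | succ n ih =>
    refine base D (fun r m => ?_) h
    have h2 : commR D r = 0 := by
      refine ih (hD r) (fun m => ?_)
      rw [commR_apply, h m, smul_comm r (g : R) m, h (r • m)]; simp
    have h3 := LinearMap.congr_fun h2 m
    simpa [sub_eq_zero] using h3

theorem IsDiffOp.exists_div {M : Type*} [AddCommGroup M] [Module R M] {n : ℕ}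
    {D : M →ₗ[ℤ] Localization W} (hD : IsDiffOp R n D) (g : W) :
    ∃ E : M →ₗ[ℤ] Localization W, IsDiffOp R n E ∧ ∀ m, E ((g : R) • m) = D m := by
  induction n generalizing D with
  | zero =>
    refine ⟨LinearMap.mulLeft ℤ (Localization.mk 1 g) ∘ₗ D, hD.mulLeft _, fun m => ?_⟩
    rw [LinearMap.comp_apply, hD, LinearMap.mulLeft_apply, smul_mk_one]
  | succ n ih =>
    obtain ⟨E, hE, hEg⟩ := ih (hD g)
    refine ⟨LinearMap.mulLeft ℤ (Localization.mk 1 g) ∘ₗ (D + -E),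
      (hD.add hE.succ.neg).mulLeft _, fun m => ?_⟩
    have : (D + -E) ((g : R) • m) = (g : R) • D m := by
      rw [LinearMap.add_apply, LinearMap.neg_apply, hEg, commR_apply]; abel
    rw [LinearMap.comp_apply, this, LinearMap.mulLeft_apply, smul_mk_one]

theorem ext_unique {D E : Module.End ℤ (Localization W)} (hD : ∃ n, IsDiffOp R n D)
    (hE : ∃ n, IsDiffOp R n E)
    (h : ∀ x : R, D (algebraMap R _ x) = E (algebraMap R _ x)) : D = E := by
  have main : ∀ (n : ℕ) (F : Module.End ℤ (Localization W)), IsDiffOp R n F →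
      (∀ x : R, F (algebraMap R _ x) = 0) → F = 0 := by
    have base : ∀ F : Module.End ℤ (Localization W), IsDiffOp R 0 F →
        (∀ x : R, F (algebraMap R _ x) = 0) → F = 0 := by
      intro F hF h0
      ext y
      obtain ⟨x, s, rfl⟩ := IsLocalization.exists_mk'_eq W y
      have h1 := hF s (IsLocalization.mk' (Localization W) x s)
      rw [Algebra.smul_def, IsLocalization.mk'_spec', h0] at h1
      rw [← smul_mk_one s (F _), ← h1]; simp
    intro n
    induction n with
    | zero => exact base
    | succ n ih =>
      intro F hF h0
      refine base F (fun r y => ?_) h0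
      have h2 : commR F r = 0 := by
        refine ih _ (hF r) (fun x => ?_)
        rw [commR_apply, h0 x, Algebra.smul_def, ← map_mul, h0]; simp
      have h3 := LinearMap.congr_fun h2 y
      simpa [sub_eq_zero] using h3
  obtain ⟨m, hm⟩ := hD
  obtain ⟨n, hn⟩ := hE
  have := main (max m n) (D + -E)
    ((hm.mono (le_max_left m n)).add (hn.mono (le_max_right m n)).neg)
    (fun x => by rw [LinearMap.add_apply, LinearMap.neg_apply, h x, add_neg_cancel])
  rwa [← sub_eq_add_neg, sub_eq_zero] at this

theorem exists_ext (D : diffOp R) (W : Submonoid R) :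
    ∃ E : Module.End ℤ (Localization W), (∃ n, IsDiffOp R n E) ∧
      ∀ x : R, E (algebraMap R _ x) = algebraMap R _ ((D : Module.End ℤ R) x) := by
  obtain ⟨D, n, hD⟩ := D
  have hι : IsDiffOp R n (locMap W ∘ₗ D) := by simpa using locMap_isDiffOp.comp hD
  choose T hT hTg using fun g : W => hι.exists_div g
  have hmul : ∀ (g h : W) (x : R), T (g * h) ((h : R) * x) = T g x := by
    intro g h x
    have hz : T (g * h) ∘ₗ mulBy R (h : R) + -T g = 0 := by
      have hmb : IsDiffOp R 0 (mulBy R (h : R)) := fun r m => by simp; ring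
      have hc : IsDiffOp R n (T (g * h) ∘ₗ mulBy R (h : R)) := (hT (g * h)).comp hmb
      refine (hc.add (hT g).neg).eq_zero g (fun m => ?_)
      have e1 := hTg (g * h) m
      have e2 := hTg g m
      have e3 : (h : R) • (g : R) • m = ((g * h : W) : R) • m := by
        simp only [smul_eq_mul, Submonoid.coe_mul]; ring
      rw [LinearMap.add_apply, LinearMap.neg_apply, LinearMap.comp_apply, mulBy_apply, e3, e1, e2,
        add_neg_cancel]
    have := LinearMap.congr_fun hz x
    simpa [← sub_eq_add_neg, sub_eq_zero] using this
  have hwd : ∀ (g h : W) (x y : R), Localization.mk x g = Localization.mk y h → T g x = T h y := by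
    intro g h x y hxy
    rw [Localization.mk_eq_mk_iff, Localization.r_iff_exists] at hxy
    obtain ⟨c, hc⟩ := hxy
    rw [← hmul g (c * h) x, ← hmul h (c * g) y]
    have e1 : g * (c * h) = h * (c * g) := by
      rw [mul_left_comm g, mul_left_comm h, mul_comm g h]
    have e2 : ((c * h : W) : R) * x = ((c * g : W) : R) * y := by
      simp only [Submonoid.coe_mul, mul_assoc]; exact hc
    rw [e1, e2]
  have hsec : ∀ y : Localization W, ∃ z : R × W, Localization.mk z.1 z.2 = y := by
    intro y
    induction y using Localization.induction_on with
    | H z => exact ⟨z, rfl⟩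
  choose s hs using hsec
  have hval : ∀ (x : R) (g : W), T (s (Localization.mk x g)).2 (s (Localization.mk x g)).1
      = T g x := fun x g => hwd _ _ _ _ (hs _)
  let E : Localization W →+ Localization W :=
    AddMonoidHom.mk' (fun y => T (s y).2 (s y).1) (by
      intro a b
      induction a using Localization.induction_on with
      | H a =>
      induction b using Localization.induction_on with
      | H b =>
      rw [Localization.add_mk, hval, hval, hval, map_add, hmul, mul_comm a.2 b.2, hmul, add_comm])
  have hE : ∀ (x : R) (g : W), E (Localization.mk x g) = T g x := hval
  refine ⟨E.toIntLinearMap, ⟨n, ?_⟩, fun x => ?_⟩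
  · have gen : ∀ (k : ℕ) (F : Module.End ℤ (Localization W)) (U : W → (R →ₗ[ℤ] Localization W)),
        (∀ g, IsDiffOp R k (U g)) → (∀ (x : R) (g : W), F (Localization.mk x g) = U g x) →
        IsDiffOp R k F := by
      intro k
      induction k with
      | zero =>
        intro F U hU hF r y
        induction y using Localization.induction_on with
        | H z => rw [Localization.smul_mk, hF, hF, hU]
      | succ k ih =>
        intro F U hU hF r
        refine ih _ (fun g => commR (U g) r) (fun g => hU g r) (fun x g => ?_)
        rw [commR_apply, commR_apply, Localization.smul_mk, hF, hF]
    exact gen n _ T hT hE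
  · have h1 := hTg 1 x
    rw [← Localization.mk_one_eq_algebraMap]
    simpa [hE] using h1

/-- The extension of a differential operator of `R` to the localization `W⁻¹R`: the unique
differential operator of `W⁻¹R` (of finite order over `R`) that agrees with it on `R`. -/
noncomputable def extendOp (W : Submonoid R) (D : diffOp R) : Module.End ℤ (Localization W) :=
  (exists_ext D W).choose

theorem extendOp_isDiffOp (D : diffOp R) : ∃ n, IsDiffOp R n (extendOp W D) :=
  (exists_ext D W).choose_spec.1

theorem extendOp_algebraMap (D : diffOp R) (x : R) :
    extendOp W D (algebraMap R _ x) = algebraMap R _ ((D : Module.End ℤ R) x) :=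
  (exists_ext D W).choose_spec.2 x

/-- The extension of differential operators to `W⁻¹R` as a ring homomorphism. -/
noncomputable def extendHom (W : Submonoid R) : diffOp R →+* Module.End ℤ (Localization W) where
  toFun := extendOp W
  map_one' := ext_unique (extendOp_isDiffOp 1) ⟨0, fun _ _ => rfl⟩
    (fun x => by rw [extendOp_algebraMap]; rfl)
  map_mul' D E := by
    obtain ⟨m, hm⟩ := extendOp_isDiffOp (W := W) D
    obtain ⟨n, hn⟩ := extendOp_isDiffOp (W := W) E
    refine ext_unique (extendOp_isDiffOp _) ⟨m + n, hm.comp hn⟩ (fun x => ?_)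
    rw [Module.End.mul_apply, extendOp_algebraMap, extendOp_algebraMap, extendOp_algebraMap]; rfl
  map_zero' := ext_unique (extendOp_isDiffOp 0) ⟨0, IsDiffOp.zero_map 0⟩
    (fun x => by rw [extendOp_algebraMap]; simp)
  map_add' D E := by
    obtain ⟨m, hm⟩ := extendOp_isDiffOp (W := W) D
    obtain ⟨n, hn⟩ := extendOp_isDiffOp (W := W) E
    refine ext_unique (extendOp_isDiffOp _)
      ⟨max m n, (hm.mono (le_max_left m n)).add (hn.mono (le_max_right m n))⟩ (fun x => ?_)
    rw [LinearMap.add_apply, extendOp_algebraMap, extendOp_algebraMap, extendOp_algebraMap,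
      Subring.coe_add, LinearMap.add_apply, map_add]

/-- The `D_R`-module structure of the localization `W⁻¹R` (in particular of `R_f`). It satisfies
the recursion on the order that is customarily used to define it, see `diffOp_smul_order_zero` and
`diffOp_smul_mk`. -/
noncomputable instance diffOpModule (W : Submonoid R) : Module (diffOp R) (Localization W) :=
  Module.compHom (Localization W) (extendHom W)

theorem diffOp_smul_def (D : diffOp R) (y : Localization W) : D • y = extendOp W D y := rfl

/-- The localization map `R → W⁻¹R` is compatible with the actions of `D_R`. -/
theorem diffOp_smul_algebraMap (D : diffOp R) (x : R) :
    D • algebraMap R (Localization W) x = algebraMap R _ ((D : Module.End ℤ R) x) :=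
  extendOp_algebraMap D x

/-- The commutator `[D, r]` as an element of `D_R`. -/
def commOp (D : diffOp R) (r : R) : diffOp R :=
  ⟨commR (D : Module.End ℤ R) r, by
    obtain ⟨D, n, hn⟩ := D
    exact ⟨n, hn.succ r⟩⟩

/-- An operator of order zero acts by `D • (v / g) = D v / g`. -/
theorem diffOp_smul_order_zero (D : diffOp R) (hD : IsDiffOp R 0 (D : Module.End ℤ R)) (v : R)
    (g : W) :
    D • (Localization.mk v g : Localization W) = Localization.mk ((D : Module.End ℤ R) v) g := by
  obtain ⟨a, ha⟩ := (isDiffOp_zero_iff _).1 hD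
  have : extendOp W D = mulBy (Localization W) a := by
    refine ext_unique (extendOp_isDiffOp D) ⟨0, fun r m => by simp [smul_comm r a m]⟩ (fun x => ?_)
    rw [extendOp_algebraMap, ha, mulBy_apply, Algebra.smul_def, map_mul]
  rw [diffOp_smul_def, this, mulBy_apply, Localization.smul_mk, ha, smul_eq_mul]

/-- The recursion `D • (v / g) = (D v - [D, g] • (v / g)) / g`. -/
theorem diffOp_smul_mk (D : diffOp R) (v : R) (g : W) :
    D • (Localization.mk v g : Localization W) = Localization.mk 1 g *
      (algebraMap R _ ((D : Module.End ℤ R) v) -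
        commOp D (g : R) • (Localization.mk v g : Localization W)) := by
  have h1 : extendOp W (commOp D (g : R)) = commR (extendOp W D) (g : R) := by
    obtain ⟨n, hn⟩ := extendOp_isDiffOp (W := W) D
    refine ext_unique (extendOp_isDiffOp _) ⟨n, hn.succ g⟩ (fun x => ?_)
    rw [extendOp_algebraMap, commR_apply, extendOp_algebraMap, Algebra.smul_def,
      Algebra.smul_def, ← map_mul, extendOp_algebraMap, ← map_mul, ← map_sub]; rfl
  have h2 : (g : R) • (Localization.mk v g : Localization W) = algebraMap R _ v := by
    rw [Localization.smul_mk, ← Localization.mk_one_eq_algebraMap, Localization.mk_eq_mk_iff,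
      Localization.r_iff_exists]
    exact ⟨1, by simp⟩
  rw [diffOp_smul_def, diffOp_smul_def, h1, commR_apply, h2, extendOp_algebraMap, sub_sub_cancel,
    smul_mk_one]

end Extension

/-- A ring `S` of prime characteristic `p` is `F`-finite if it is a finitely generated module over
itself through the Frobenius endomorphism. -/
def IsFFinite (p : ℕ) (S : Type*) [CommRing S] [ExpChar S p] : Prop :=
  (frobenius S p).Finite

/-- The `R`-algebra `S` contains `R` as a direct summand: the structure map `R → S` has an
`R`-linear left inverse (in particular it is injective). -/
def IsDirectSummand (R S : Type*) [CommRing R] [CommRing S] [Algebra R S] : Prop :=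
  ∃ β : S →ₗ[R] R, ∀ r : R, β (algebraMap R S r) = r

end DSummand

/-!
Let `f ∈ S` and `q = p ^ (e + 1)`. An additive map `D : S → S` that is linear over `q`-th powers
extends to `S_f` and maps `1 / f = f ^ (q - 1) / f ^ q` to `D (f ^ (q - 1)) / f ^ q`. So if
`D (f ^ (q - 1)) = f ^ (q - p)`, then `D` maps `1 / f` to `1 / f ^ p`. Such a `D` is a differential
operator because `S` is finite over its `q`-th powers (`exists_isDiffOp_of_powLinear`). For
`f ∈ R`, composing `D` with a splitting `β : S → R` gives a differential operator of `R`
(`IsDiffOp.comp_algebraMap`) with the same effect on `1 / f`. Applied to `f, f ^ p, f ^ p², ...` in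
turn, this shows that all `1 / f ^ p ^ k` lie in `D_R • (1 / f)`, and these generate `R_f` over `R`.

The existence of `D` (`exists_powLinear_apply_eq`) rests on two facts.

* Kunz's theorem: Frobenius is flat on a regular ring (`flat_frobenius`). A regular local ring has
  a regular sequence generating its maximal ideal; the `p`-th powers still form a regular sequence,
  so that sequence is regular on the Frobenius pushforward, which is therefore free. With
  `F`-finiteness this provides a finite dual basis `y = ∑ i, c i y ^ p * b i` of `S` over its `p`-th
  powers.
* Stabilization: let `C 0 = S` and let `C (e + 1)` be generated by all `φ (f ^ (p - 1) * y)` with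
  `y ∈ C e` and `φ` a `p⁻¹`-linear map. This descending chain satisfies
  `C e = C (e + 1)` for some `e` (`exists_cartierIter_eq_succ`, the principle of
  Hartshorne–Speiser–Lyubeznik and Gabber).

The dual basis shows that `f ^ (p ^ e - 1)` lies in the Frobenius power `C e ^ [p ^ e]`, and
elements of `C e ^ [p ^ e]` are values at `f ^ (p ^ e - 1)` of maps linear over `p ^ e`-th powers.
If `C e = C (e + 1)`, then `f ^ (q - p) = (f ^ (p ^ e - 1)) ^ p` lies in `C (e + 1) ^ [q]`, so it is
the value at `f ^ (q - 1)` of a map linear over `q`-th powers.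
-/

namespace DSummand

/-! ### Regular sequences in regular local rings -/

section Regular

open RingTheory.Sequence IsLocalRing

/-- Exchange: an element of `𝔪` outside `𝔪²` replaces some member of a given finite generating
set of `𝔪`. -/
theorem exists_sup_span_erase_eq_maximalIdeal {A : Type*} [CommRing A] [IsLocalRing A]
    [DecidableEq A] {x : A} (hx : x ∈ maximalIdeal A) (hx2 : x ∉ maximalIdeal A ^ 2) (s : Finset A)
    (hs : Ideal.span (s : Set A) = maximalIdeal A) :
    ∃ y ∈ s, Ideal.span {x} ⊔ Ideal.span ((s.erase y : Finset A) : Set A) = maximalIdeal A := by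
  have hx' := hx
  rw [← hs, Ideal.span, Submodule.mem_span_finset] at hx'
  obtain ⟨a, -, ha⟩ := hx'
  have hsm : ∀ y ∈ s, y ∈ maximalIdeal A := fun y hy => hs ▸ Ideal.subset_span hy
  obtain ⟨y, hy, hay⟩ : ∃ y ∈ s, IsUnit (a y) := by
    by_contra! h
    refine hx2 (ha ▸ Ideal.sum_mem _ fun y hy => ?_)
    rw [smul_eq_mul, pow_two]
    exact Ideal.mul_mem_mul ((mem_maximalIdeal _).2 (h y hy)) (hsm y hy)
  refine ⟨y, hy, le_antisymm (sup_le ?_ ?_) ?_⟩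
  · rwa [Ideal.span_singleton_le_iff_mem]
  · rw [Ideal.span_le]
    exact fun z hz => hsm z (Finset.mem_of_mem_erase hz)
  · have herase : ∀ z ∈ s.erase y, z ∈ Ideal.span {x} ⊔
        Ideal.span ((s.erase y : Finset A) : Set A) :=
      fun z hz => Ideal.mem_sup_right (Ideal.subset_span hz)
    rw [← hs, Ideal.span_le]
    intro z hz
    by_cases hzy : z = y
    · subst hzy
      rw [SetLike.mem_coe, ← Ideal.unit_mul_mem_iff_mem _ hay]
      rw [← Finset.add_sum_erase s _ hy] at ha
      rw [smul_eq_mul] at ha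
      rw [eq_sub_of_add_eq ha]
      refine sub_mem (Ideal.mem_sup_left (Ideal.mem_span_singleton_self x)) ?_
      exact Ideal.sum_mem _ fun w hw => Ideal.mul_mem_left _ _ (herase w hw)
    · exact herase z (Finset.mem_erase.2 ⟨hzy, hz⟩)

/-- Prime avoidance, applied to the minimal primes and to `𝔪²`. -/
theorem exists_mem_maximalIdeal_notMem_minimalPrimes {A : Type*} [CommRing A]
    [IsLocalRing A] [IsNoetherianRing A] (hdim : 0 < (maximalIdeal A).height) :
    ∃ x ∈ maximalIdeal A, x ∉ maximalIdeal A ^ 2 ∧ ∀ Q ∈ minimalPrimes A, x ∉ Q := by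
  by_contra! h
  have hsub : (maximalIdeal A : Set A) ⊆ ⋃ Q ∈ insert (maximalIdeal A ^ 2) (minimalPrimes A),
      (Q : Set A) := by
    intro x hx
    by_cases hx2 : x ∈ maximalIdeal A ^ 2
    · exact Set.mem_biUnion (Set.mem_insert _ _) hx2
    · obtain ⟨Q, hQ, hxQ⟩ := h x hx hx2
      exact Set.mem_biUnion (Set.mem_insert_of_mem _ hQ) hxQ
  obtain ⟨Q, hQ, hle⟩ := (Ideal.subset_union_prime_finite
    ((minimalPrimes.finite_of_isNoetherianRing A).insert (maximalIdeal A ^ 2)) (f := id)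
    (maximalIdeal A ^ 2) (maximalIdeal A ^ 2) (by
      rintro Q (rfl | hQ) h1 h2
      · exact absurd rfl h1
      · exact hQ.1.1)).1 hsub
  rcases hQ with rfl | hQ
  · have hbot : maximalIdeal A = ⊥ := by
      refine Submodule.eq_bot_of_le_smul_of_le_jacobson_bot (maximalIdeal A) _
        (IsNoetherian.noetherian _) ?_ (maximalIdeal_le_jacobson _)
      rw [smul_eq_mul, ← pow_two]; exact hle
    rw [hbot] at hdim
    simp at hdim
  · have hmQ : maximalIdeal A = Q := le_antisymm hle (le_maximalIdeal hQ.1.1.ne_top)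
    rw [Ideal.height_eq_zero_iff.2 (hmQ ▸ hQ)] at hdim
    simp at hdim

section Quotient

variable {A : Type*} [CommRing A] {x : A}

theorem isLocalRing_quotient_span_singleton [IsLocalRing A] (hx : x ∈ maximalIdeal A) :
    IsLocalRing (A ⧸ Ideal.span {x}) := by
  have : Nontrivial (A ⧸ Ideal.span {x}) := Ideal.Quotient.nontrivial_iff.2 fun h =>
    (maximalIdeal.isMaximal A).ne_top
      (top_le_iff.1 (h ▸ (Ideal.span_singleton_le_iff_mem _).2 hx))
  exact IsLocalRing.of_surjective' (Ideal.Quotient.mk _) Ideal.Quotient.mk_surjective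

theorem map_mk_maximalIdeal [IsLocalRing A] [IsLocalRing (A ⧸ Ideal.span {x})] :
    (maximalIdeal A).map (Ideal.Quotient.mk (Ideal.span {x})) =
      maximalIdeal (A ⧸ Ideal.span {x}) := by
  have h := eq_maximalIdeal (Ideal.comap_isMaximal_of_surjective
    (Ideal.Quotient.mk (Ideal.span {x})) Ideal.Quotient.mk_surjective
    (K := maximalIdeal (A ⧸ Ideal.span {x})))
  rw [← h, Ideal.map_comap_of_surjective _ Ideal.Quotient.mk_surjective]

theorem map_mk_ofList (xs : List A) :
    (Ideal.ofList (x :: xs)).map (Ideal.Quotient.mk (Ideal.span {x})) =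
      Ideal.ofList (xs.map (Ideal.Quotient.mk (Ideal.span {x}))) := by
  rw [Ideal.ofList_cons, Ideal.map_sup, Ideal.map_ofList, Ideal.map_span, Set.image_singleton,
    Ideal.Quotient.eq_zero_iff_mem.2 (Ideal.mem_span_singleton_self x),
    Ideal.span_singleton_eq_bot.2 rfl, bot_sup_eq]

end Quotient

theorem isWeaklyRegular_self_cons_iff {A : Type*} [CommRing A] (x : A) (xs : List A) :
    IsWeaklyRegular A (x :: xs) ↔ IsSMulRegular A x ∧
      IsWeaklyRegular (A ⧸ Ideal.span {x}) (xs.map (Ideal.Quotient.mk (Ideal.span {x}))) := by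
  have e : QuotSMulTop x A ≃ₗ[A] A ⧸ Ideal.span {x} :=
    Submodule.quotEquivOfEq _ _ (by rw [← Submodule.ideal_span_singleton_smul]; simp)
  rw [isWeaklyRegular_cons_iff, e.isWeaklyRegular_congr]
  exact and_congr_right fun _ =>
    (isWeaklyRegular_map_algebraMap_iff (S := A ⧸ Ideal.span {x}) (A ⧸ Ideal.span {x}) xs).symm

/-- Krull: if `A / x` is a domain and `x` lies in no minimal prime of the Noetherian local ring
`A`, then `A` is a domain, since a minimal prime `Q ⊆ (x)` satisfies `Q = xQ`. -/
theorem isDomain_of_isDomain_quotient {A : Type*} [CommRing A] [IsLocalRing A]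
    [IsNoetherianRing A] {x : A} (hx : x ∈ maximalIdeal A) (hxQ : ∀ Q ∈ minimalPrimes A, x ∉ Q)
    [IsDomain (A ⧸ Ideal.span {x})] : IsDomain A := by
  have : (Ideal.span {x}).IsPrime := (Ideal.Quotient.isDomain_iff_prime _).1 inferInstance
  obtain ⟨Q, hQ, hQx⟩ := Ideal.exists_minimalPrimes_le (I := ⊥) (J := Ideal.span {x}) bot_le
  have hQp : Q.IsPrime := hQ.1.1
  have hbot : Q = ⊥ := by
    refine Submodule.eq_bot_of_le_smul_of_le_jacobson_bot (Ideal.span {x}) _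
      (IsNoetherian.noetherian _) (fun y hy => ?_)
      (((Ideal.span_singleton_le_iff_mem _).2 hx).trans (maximalIdeal_le_jacobson _))
    obtain ⟨a, rfl⟩ := Ideal.mem_span_singleton'.1 (hQx hy)
    rw [mul_comm, smul_eq_mul]
    exact Ideal.mul_mem_mul (Ideal.mem_span_singleton_self x)
      ((hQp.mem_or_mem hy).resolve_right (hxQ Q hQ))
  subst hbot
  exact IsDomain.of_bot_isPrime A

/-- A regular local ring is a domain, and its maximal ideal is generated by a regular sequence.
Both are obtained together, by induction on the dimension. -/
theorem isDomain_and_exists_isWeaklyRegular (n : ℕ) (A : Type*) [CommRing A]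
    [IsRegularLocalRing A] (hn : (maximalIdeal A).spanFinrank = n) :
    IsDomain A ∧ ∃ xs : List A, Ideal.ofList xs = maximalIdeal A ∧ IsWeaklyRegular A xs := by
  classical
  induction n generalizing A with
  | zero =>
    have hbot := (Submodule.spanFinrank_eq_zero_iff_eq_bot (IsNoetherian.noetherian _)).1 hn
    have hf : IsField A := isField_iff_maximalIdeal_eq.2 hbot
    exact ⟨hf.isDomain, [], by simp [hbot], IsWeaklyRegular.nil _ _⟩
  | succ n ih =>
    have hdim := IsRegularLocalRing.spanFinrank_maximalIdeal (R := A)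
    rw [hn] at hdim
    have hht : 0 < (maximalIdeal A).height := by
      rw [← maximalIdeal_height_eq_ringKrullDim] at hdim
      rw [pos_iff_ne_zero]
      intro h0
      rw [h0] at hdim
      norm_cast at hdim
    obtain ⟨x, hx, hx2, hxQ⟩ := exists_mem_maximalIdeal_notMem_minimalPrimes hht
    obtain ⟨s, hscard, hs⟩ := Submodule.FG.exists_span_finset_card_eq_spanFinrank
      (IsNoetherian.noetherian (maximalIdeal A))
    -- `x` replaces one of `n + 1` generators of `𝔪`, so `n` generators suffice modulo `x`, while
    -- the dimension drops by at most one: `A / x` is again regular.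
    obtain ⟨y, hy, hsup⟩ := exists_sup_span_erase_eq_maximalIdeal hx hx2 s hs
    have := isLocalRing_quotient_span_singleton hx
    have hdim' := ringKrullDim_le_ringKrullDim_quotient_add_card ({x} : Finset A)
      (by simpa [IsLocalRing.ringJacobson_eq_maximalIdeal] using hx)
    rw [Finset.coe_singleton, Finset.card_singleton, ← hdim] at hdim'
    have hrank : (maximalIdeal (A ⧸ Ideal.span {x})).spanFinrank ≤ n := by
      have hmax : maximalIdeal (A ⧸ Ideal.span {x}) =
          Ideal.span (((s.erase y).image (Ideal.Quotient.mk (Ideal.span {x})) : Finset _) :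
            Set (A ⧸ Ideal.span {x})) := by
        rw [← map_mk_maximalIdeal, ← hsup, Ideal.map_sup, Ideal.map_quotient_self, bot_sup_eq,
          Ideal.map_span, Finset.coe_image]
      rw [hmax]
      refine (Submodule.spanFinrank_span_le_ncard_of_finite (Finset.finite_toSet _)).trans ?_
      rw [Set.ncard_coe_finset]
      refine Finset.card_image_le.trans ?_
      rw [Finset.card_erase_of_mem hy, hscard, hn, Nat.add_sub_cancel]
    have hn' : (n : WithBot ℕ∞) ≤ ringKrullDim (A ⧸ Ideal.span {x}) := by
      push_cast at hdim'
      exact ENat.WithBot.add_le_add_one_right_iff.1 hdim'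
    have hreg : IsRegularLocalRing (A ⧸ Ideal.span {x}) :=
      IsRegularLocalRing.of_spanFinrank_maximalIdeal_le _
        (le_trans (by exact_mod_cast hrank) hn')
    have hrank' : (maximalIdeal (A ⧸ Ideal.span {x})).spanFinrank = n := by
      refine le_antisymm hrank ?_
      rw [← IsRegularLocalRing.spanFinrank_maximalIdeal] at hn'
      exact_mod_cast hn'
    obtain ⟨hdom, ys, hys, hysreg⟩ := ih (A ⧸ Ideal.span {x}) hrank'
    have hA : IsDomain A := isDomain_of_isDomain_quotient hx hxQ
    obtain ⟨xs, rfl⟩ := List.map_surjective_iff.2 Ideal.Quotient.mk_surjective ys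
    refine ⟨hA, x :: xs, ?_, ?_⟩
    · have h := congrArg (Ideal.comap (Ideal.Quotient.mk (Ideal.span {x}))) hys
      have hle : ∀ I : Ideal A, x ∈ I → (I.map (Ideal.Quotient.mk (Ideal.span {x}))).comap
          (Ideal.Quotient.mk (Ideal.span {x})) = I := fun I hI => by
        rw [Ideal.comap_map_of_surjective _ Ideal.Quotient.mk_surjective,
          ← RingHom.ker_eq_comap_bot, Ideal.mk_ker, sup_eq_left, Ideal.span_singleton_le_iff_mem]
        exact hI
      rwa [← map_mk_ofList, ← map_mk_maximalIdeal, hle _ hx, hle] at h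
      exact Ideal.subset_span (by simp)
    · rw [isWeaklyRegular_self_cons_iff]
      refine ⟨?_, hysreg⟩
      have hx0 : x ≠ 0 := by
        rintro rfl
        exact hx2 (zero_mem _)
      exact IsSMulRegular.of_ne_zero hx0

/-- Over a Noetherian local ring whose maximal ideal is generated by a regular sequence, a finite
module on which that sequence is regular is free. -/
theorem free_of_isWeaklyRegular (n : ℕ) {A M : Type*} [CommRing A] [IsLocalRing A]
    [IsNoetherianRing A] [AddCommGroup M] [Module A M] [Module.Finite A M] (xs : List A)
    (hlen : xs.length = n) (hxs : Ideal.ofList xs = maximalIdeal A) (hA : IsWeaklyRegular A xs)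
    (hM : IsWeaklyRegular M xs) : Module.Free A M := by
  induction n generalizing A M with
  | zero =>
    rw [List.length_eq_zero_iff.1 hlen, Ideal.ofList_nil] at hxs
    let := (isField_iff_maximalIdeal_eq.2 hxs.symm).toField
    infer_instance
  | succ n ih =>
    obtain _ | ⟨x, xs⟩ := xs
    · simp at hlen
    have hx : x ∈ maximalIdeal A := hxs ▸ Ideal.subset_span (by simp)
    have := isLocalRing_quotient_span_singleton hx
    have := Module.Finite.of_restrictScalars_finite A (A ⧸ Ideal.span {x}) (QuotSMulTop x M)
    have := Module.finitePresentation_of_finite A M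
    rw [isWeaklyRegular_self_cons_iff] at hA
    rw [isWeaklyRegular_cons_iff'] at hM
    rw [← Module.free_quotSMulTop_iff_free A M (maximalIdeal_le_jacobson _ hx) hM.1]
    refine ih (xs.map _) (by simpa using hlen) ?_ hA.2 hM.2
    rw [← map_mk_ofList, hxs, map_mk_maximalIdeal]

/-! ### Kunz's theorem on the flatness of Frobenius -/

/-- A regular sequence of members of `𝔪` on a Noetherian module stays regular when an initial
segment is raised to powers. The sequence may be permuted, so each member in turn is raised to a
power in the last position, where this is evidently harmless. -/
theorem isWeaklyRegular_map_pow_append {A M : Type*} [CommRing A] [IsLocalRing A]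
    [AddCommGroup M] [Module A M] [IsNoetherian A M] (k : ℕ) (xs ys : List A)
    (hm : ∀ x ∈ xs ++ ys, x ∈ maximalIdeal A) (hk : k ≠ 0) (h : IsWeaklyRegular M (xs ++ ys)) :
    IsWeaklyRegular M (xs.map (· ^ k) ++ ys) := by
  induction xs generalizing ys with
  | nil => exact h
  | cons x xs ih =>
    have hp : (x :: xs ++ ys).Perm (xs ++ (ys ++ [x])) := by
      rw [List.cons_append, ← List.append_assoc]
      exact (List.perm_append_singleton x (xs ++ ys)).symm
    have h1 := ih (ys ++ [x]) (fun z hz => hm z (hp.mem_iff.2 hz))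
      (isWeaklyRegular_of_perm_of_subset_maximalIdeal h hp hm)
    rw [← List.append_assoc, isWeaklyRegular_append_iff] at h1
    have h2 : IsWeaklyRegular M (xs.map (· ^ k) ++ ys ++ [x ^ k]) := by
      rw [isWeaklyRegular_append_iff]
      refine ⟨h1.1, ?_⟩
      rw [isWeaklyRegular_singleton_iff]
      exact ((isWeaklyRegular_singleton_iff _ _).1 h1.2).pow k
    refine isWeaklyRegular_of_perm_of_subset_maximalIdeal h2
      (List.perm_append_singleton (x ^ k) (xs.map (· ^ k) ++ ys)) fun z hz => ?_
    simp only [List.mem_append, List.mem_map, List.mem_singleton] at hz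
    rcases hz with (⟨w, hw, rfl⟩ | hz) | rfl
    · exact Ideal.pow_mem_of_mem _ (hm w (by simp [hw])) k (Nat.pos_of_ne_zero hk)
    · exact hm z (by simp [hz])
    · exact Ideal.pow_mem_of_mem _ (hm x (by simp)) k (Nat.pos_of_ne_zero hk)

theorem flat_of_isWeaklyRegular_map {A B : Type*} [CommRing A] [IsLocalRing A]
    [IsNoetherianRing A] [CommRing B] (φ : A →+* B) (hφ : φ.Finite) (xs : List A)
    (hxs : Ideal.ofList xs = maximalIdeal A) (hA : IsWeaklyRegular A xs)
    (hB : IsWeaklyRegular B (xs.map φ)) : φ.Flat := by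
  algebraize [φ]
  have h := (isWeaklyRegular_map_algebraMap_iff (S := B) B xs).1 hB
  have := free_of_isWeaklyRegular _ xs rfl hxs hA h
  rw [RingHom.Flat]
  infer_instance

/-- Kunz: the Frobenius endomorphism of an `F`-finite regular local ring is flat. -/
theorem flat_frobenius_of_isRegularLocalRing (p : ℕ) [hp : Fact p.Prime] (A : Type*) [CommRing A]
    [ExpChar A p] [IsRegularLocalRing A] (hfin : (frobenius A p).Finite) :
    (frobenius A p).Flat := by
  obtain ⟨-, xs, hxs, hreg⟩ := isDomain_and_exists_isWeaklyRegular _ A rfl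
  refine flat_of_isWeaklyRegular_map _ hfin xs hxs hreg ?_
  have h := isWeaklyRegular_map_pow_append (M := A) p xs [] (fun x hx => by
    rw [← hxs]; exact Ideal.subset_span (by simpa using hx)) hp.out.ne_zero (by simpa using hreg)
  rw [List.append_nil] at h
  exact h

theorem finite_iff_exists_sum {A B : Type*} [CommRing A] [CommRing B] (φ : A →+* B) :
    φ.Finite ↔ ∃ (n : ℕ) (b : Fin n → B), ∀ y, ∃ a : Fin n → A, ∑ i, φ (a i) * b i = y := by
  algebraize_only [φ]
  rw [RingHom.Finite, Module.finite_def, Submodule.fg_iff_exists_fin_generating_family]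
  refine exists_congr fun n => exists_congr fun b => ?_
  simp_rw [Submodule.eq_top_iff', Submodule.mem_span_range_iff_exists_fun]
  rfl

theorem finite_frobenius_of_isLocalization (p : ℕ) [hp : Fact p.Prime] {S T : Type*} [CommRing S]
    [CommRing T] [Algebra S T] (W : Submonoid S) [IsLocalization W T] [ExpChar S p] [ExpChar T p]
    (hfin : (frobenius S p).Finite) : (frobenius T p).Finite := by
  rw [finite_iff_exists_sum] at hfin ⊢
  obtain ⟨n, b, hb⟩ := hfin
  refine ⟨n, fun i => algebraMap S T (b i), fun y => ?_⟩
  obtain ⟨s, t, rfl⟩ := IsLocalization.exists_mk'_eq W y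
  -- `s / t = s t ^ (p - 1) / t ^ p`
  obtain ⟨a, ha⟩ := hb (s * (t : S) ^ (p - 1))
  refine ⟨fun i => IsLocalization.mk' T (a i) t, ?_⟩
  have ht : IsUnit (algebraMap S T t ^ p) := (IsLocalization.map_units T t).pow p
  refine ht.mul_left_injective ?_
  have hi : ∀ i, frobenius T p (IsLocalization.mk' T (a i) t) * algebraMap S T (b i) *
      algebraMap S T t ^ p = algebraMap S T (frobenius S p (a i) * b i) := by
    intro i
    rw [mul_right_comm, frobenius_def, ← mul_pow, IsLocalization.mk'_spec, map_mul, frobenius_def,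
      map_pow]
  simp only [Finset.sum_mul, hi]
  rw [← map_sum, ha, map_mul, map_pow, ← IsLocalization.mk'_spec T s t, mul_assoc, ← pow_succ',
    Nat.sub_add_cancel hp.out.one_le]

theorem flat_of_comp_localization {A B : Type*} [CommRing A] [CommRing B] (φ : A →+* B)
    (h : ∀ (P : Ideal B) [P.IsMaximal],
      ((algebraMap B (Localization.AtPrime P)).comp φ).Flat) : φ.Flat := by
  algebraize_only [φ]
  rw [RingHom.Flat]
  refine Module.flat_of_isLocalized_maximal B B (fun P => Localization.AtPrime P)
    (fun P => Algebra.linearMap B _) fun P _ => ?_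
  have := h P
  rw [← RingHom.algebraMap_toAlgebra φ, ← IsScalarTower.algebraMap_eq,
    RingHom.flat_algebraMap_iff] at this
  exact this

/-- Kunz: the Frobenius endomorphism of an `F`-finite regular domain is flat. -/
theorem flat_frobenius (p : ℕ) [Fact p.Prime] (S : Type*) [CommRing S] [IsDomain S]
    [ExpChar S p] [IsRegularRing S] (hS : IsFFinite p S) : (frobenius S p).Flat := by
  refine flat_of_comp_localization _ fun P _ => ?_
  have := expChar_of_injective_algebraMap
    (IsLocalization.injective (Localization.AtPrime P) P.primeCompl_le_nonZeroDivisors) p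
  have hcomm : (algebraMap S (Localization.AtPrime P)).comp (frobenius S p) =
      (frobenius (Localization.AtPrime P) p).comp (algebraMap S (Localization.AtPrime P)) :=
    by
    ext x; simp [frobenius_def]
  rw [hcomm]
  have h1 : (algebraMap S (Localization.AtPrime P)).Flat :=
    RingHom.flat_algebraMap_iff.2 (IsLocalization.flat _ P.primeCompl)
  exact h1.comp (flat_frobenius_of_isRegularLocalRing p _
    (finite_frobenius_of_isLocalization p P.primeCompl hS))

/-- A finite flat ring homomorphism out of a Noetherian ring has a finite dual basis. -/
theorem exists_dual_basis {A B : Type*} [CommRing A] [IsNoetherianRing A] [CommRing B]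
    (φ : A →+* B) (hfin : φ.Finite) (hflat : φ.Flat) :
    ∃ (n : ℕ) (b : Fin n → B) (c : Fin n → (B →+ A)),
      (∀ i a y, c i (φ a * y) = a * c i y) ∧ ∀ y, ∑ i, φ (c i y) * b i = y := by
  algebraize [φ]
  have := Module.finitePresentation_of_finite A B
  have : Module.Projective A B := Module.Flat.projective_of_finitePresentation
  obtain ⟨n, f, hf⟩ := Module.Finite.exists_fin' A B
  obtain ⟨g, hg⟩ := Module.projective_lifting_property f LinearMap.id hf
  refine ⟨n, fun i => f (Pi.single i 1), fun i => (LinearMap.proj i ∘ₗ g).toAddMonoidHom,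
    fun i a y => ?_, fun y => ?_⟩
  · have := congrFun (g.map_smul a y) i
    rw [Algebra.smul_def] at this
    exact this
  · have h1 : f (g y) = y := LinearMap.congr_fun hg y
    conv_rhs => rw [← h1, pi_eq_sum_univ' (g y), map_sum]
    refine Finset.sum_congr rfl fun i _ => ?_
    rw [map_smul, Algebra.smul_def]
    rfl

end Regular

/-! ### Stabilization of the chain of Cartier images -/

section Cartier

open IsLocalRing

/-- For `u : S`, the ideal generated by all `φ (u * y)`, where `y ∈ J` and `φ : S → S` runs over
the additive maps that are `p⁻¹`-linear, in the sense that `φ (a ^ p * y) = a * φ y`. -/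
def cartierImage {S : Type*} [CommRing S] (p : ℕ) (u : S) (J : Ideal S) : Ideal S :=
  Ideal.span {z | ∃ φ : S →+ S, (∀ a y, φ (a ^ p * y) = a * φ y) ∧ ∃ y ∈ J, φ (u * y) = z}

variable {S : Type*} [CommRing S] {p : ℕ} {u : S}

theorem mem_cartierImage {J : Ideal S} (φ : S →+ S) (hφ : ∀ a y, φ (a ^ p * y) = a * φ y) {y : S}
    (hy : y ∈ J) : φ (u * y) ∈ cartierImage p u J :=
  Ideal.subset_span ⟨φ, hφ, y, hy, rfl⟩

theorem cartierImage_le {J K : Ideal S} (h : ∀ φ : S →+ S, (∀ a y, φ (a ^ p * y) = a * φ y) →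
    ∀ y ∈ J, φ (u * y) ∈ K) : cartierImage p u J ≤ K := by
  refine Ideal.span_le.2 ?_
  rintro _ ⟨φ, hφ, y, hy, rfl⟩
  exact h φ hφ y hy

theorem cartierImage_mono : Monotone (cartierImage p u) := fun _ _ h =>
  cartierImage_le fun φ hφ _ hy => mem_cartierImage φ hφ (h hy)

theorem mul_mem_cartierImage {J K : Ideal S} {x : S} (h : ∀ y ∈ J, x ^ p * y ∈ K) {z : S}
    (hz : z ∈ cartierImage p u J) : x * z ∈ cartierImage p u K := by
  have : cartierImage p u J ≤ Submodule.comap (LinearMap.mulLeft S x) (cartierImage p u K) := by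
    refine cartierImage_le fun φ hφ y hy => ?_
    rw [Submodule.mem_comap, LinearMap.mulLeft_apply, ← hφ, mul_left_comm]
    exact mem_cartierImage φ hφ (h y hy)
  exact this hz

/-- The descending sequence of ideals obtained from the unit ideal by iterating
`cartierImage p u`. -/
def cartierIter (p : ℕ) (u : S) : ℕ → Ideal S
  | 0 => ⊤
  | e + 1 => cartierImage p u (cartierIter p u e)

theorem cartierIter_antitone : Antitone (cartierIter p u) := by
  refine antitone_nat_of_succ_le fun e => ?_
  induction e with
  | zero => exact le_top
  | succ e ih => exact cartierImage_mono ih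

theorem mul_mem_cartierIter_succ (hp : p ≠ 0) {e : ℕ} {x : S}
    (h : ∀ y ∈ cartierIter p u e, x * y ∈ cartierIter p u (e + 1)) {z : S}
    (hz : z ∈ cartierIter p u (e + 1)) : x * z ∈ cartierIter p u (e + 2) := by
  refine mul_mem_cartierImage (fun y hy => ?_) hz
  obtain ⟨k, rfl⟩ := Nat.exists_eq_succ_of_ne_zero hp
  rw [pow_succ, mul_assoc]
  exact Ideal.mul_mem_left _ _ (h y hy)

/-- The square of a multiplier of one step of the chain multiplies into every later step:
`x² C ⊆ x Φ(C) ⊆ Φ(xᵖ C)`, and `xᵖ C ⊆ x² C` lies in the step reached before. -/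
theorem sq_mul_mem_cartierIter (hp : 2 ≤ p) {e : ℕ} {x : S}
    (h : ∀ y ∈ cartierIter p u e, x * y ∈ cartierIter p u (e + 1)) (k : ℕ) {z : S}
    (hz : z ∈ cartierIter p u e) : x ^ 2 * z ∈ cartierIter p u (e + k) := by
  induction k generalizing z with
  | zero => exact Ideal.mul_mem_left _ _ hz
  | succ k ih =>
    rw [pow_two, mul_assoc]
    refine mul_mem_cartierImage (J := cartierIter p u e) (fun y hy => ?_) (h z hz)
    obtain ⟨j, rfl⟩ := Nat.exists_eq_add_of_le' hp
    rw [pow_add, mul_assoc]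
    exact Ideal.mul_mem_left _ _ (ih hy)

/-- A descending chain of submodules of a finite module `N`, all containing `𝔟 N` for an ideal `𝔟`
with Artinian quotient ring, has two equal consecutive members. -/
theorem exists_eq_succ_of_smul_le {A N : Type*} [CommRing A] [AddCommGroup N] [Module A N]
    [Module.Finite A N] (𝔟 : Ideal A) [IsArtinianRing (A ⧸ 𝔟)] (C : ℕ → Submodule A N)
    (hC : Antitone C) (hb : ∀ k, 𝔟 • ⊤ ≤ C k) : ∃ k, C k = C (k + 1) := by
  have : IsArtinian A (N ⧸ (𝔟 • ⊤ : Submodule A N)) := by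
    have : Module.Finite (A ⧸ 𝔟) (N ⧸ (𝔟 • ⊤ : Submodule A N)) :=
      Module.Finite.of_restrictScalars_finite A _ _
    have h : IsArtinian (A ⧸ 𝔟) (N ⧸ (𝔟 • ⊤ : Submodule A N)) := inferInstance
    exact isArtinian_of_surjective_algebraMap (R := A ⧸ 𝔟) Ideal.Quotient.mk_surjective
  obtain ⟨k, hk⟩ := IsArtinian.monotone_stabilizes (R := A)
    (M := N ⧸ (𝔟 • ⊤ : Submodule A N))
    ⟨fun k => OrderDual.toDual ((C k).map (𝔟 • ⊤ : Submodule A N).mkQ),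
      fun i j hij => Submodule.map_mono (hC hij)⟩
  refine ⟨k, ?_⟩
  have h : (C k).map (𝔟 • ⊤ : Submodule A N).mkQ = (C (k + 1)).map (𝔟 • ⊤ : Submodule A N).mkQ :=
    congrArg OrderDual.ofDual (hk (k + 1) (Nat.le_succ k))
  replace h := congrArg (Submodule.comap (𝔟 • ⊤ : Submodule A N).mkQ) h
  simpa [Submodule.comap_map_mkQ, hb] using h

theorem exists_notMem_forall_mul_mem {P : Ideal S} [P.IsPrime] {I J : Ideal S} (hI : I.FG)
    (h : I.map (algebraMap S (Localization.AtPrime P)) ≤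
      J.map (algebraMap S (Localization.AtPrime P))) : ∃ s ∉ P, ∀ y ∈ I, s * y ∈ J := by
  obtain ⟨t, rfl⟩ := hI
  have key : ∀ y ∈ t, ∃ s ∉ P, s * y ∈ J := by
    intro y hy
    have := h (Ideal.mem_map_of_mem _ (Ideal.subset_span hy))
    rw [IsLocalization.algebraMap_mem_map_algebraMap_iff P.primeCompl] at this
    exact this
  choose! s hsP hs using key
  refine ⟨∏ y ∈ t, s y, fun hmem => ?_, fun y hy => ?_⟩
  · obtain ⟨y, hy, hyP⟩ := (Ideal.IsPrime.prod_mem_iff).1 hmem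
    exact hsP y hy hyP
  · suffices Submodule.span S (t : Set S) ≤
        Submodule.comap (LinearMap.mulLeft S (∏ y ∈ t, s y)) J from this hy
    refine Submodule.span_le.2 fun z hz => ?_
    obtain ⟨c, hc⟩ := Finset.dvd_prod_of_mem s hz
    rw [SetLike.mem_coe, Submodule.mem_comap, LinearMap.mulLeft_apply, hc, mul_right_comm, mul_comm]
    exact J.mul_mem_left _ (hs z hz)

/-- Hartshorne–Speiser–Lyubeznik–Gabber: the descending chain `cartierIter p u` has two equal
consecutive members. The multipliers `(C (e + 1) : C e)` ascend, to a stable ideal `𝔞`. If `𝔞` were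
proper, then over the local ring at a minimal prime `P` of `𝔞` the chain from a stable index `n` on
would lie between `C n` and `𝔟 * C n`, where `𝔟` is generated by the squares from `𝔞`. Two
consecutive members would agree there, and this yields a multiplier outside `P`. -/
theorem exists_cartierIter_eq_succ [IsNoetherianRing S] (hp : 2 ≤ p) (u : S) :
    ∃ e, cartierIter p u e = cartierIter p u (e + 1) := by
  set C := cartierIter p u with hCdef
  let mult : ℕ →o Ideal S :=
    ⟨fun e => (C (e + 1)).colon (C e : Set S), monotone_nat_of_le_succ fun e x hx => by
      rw [Submodule.mem_colon] at hx ⊢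
      exact fun z hz => mul_mem_cartierIter_succ (by omega) hx hz⟩
  have hmult : ∀ e x, x ∈ mult e ↔ ∀ y ∈ C e, x * y ∈ C (e + 1) := fun e x => Submodule.mem_colon
  obtain ⟨n, hn⟩ := monotone_stabilizes_iff_noetherian.2 (inferInstance : IsNoetherian S S) mult
  refine ⟨n, le_antisymm ?_ (cartierIter_antitone (Nat.le_succ n))⟩
  suffices htop : mult n = ⊤ by
    intro y hy
    have := (hmult n 1).1 (htop ▸ Submodule.mem_top) y hy
    rwa [one_mul] at this
  by_contra hne
  obtain ⟨M, hM, hle⟩ := Ideal.exists_le_maximal _ hne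
  obtain ⟨P, hPmin, -⟩ := Ideal.exists_minimalPrimes_le hle
  have hP : P.IsPrime := hPmin.1.1
  let 𝔟 : Ideal S := Ideal.span ((fun x => x ^ 2) '' (mult n : Set S))
  have hbP : 𝔟 ≤ P := Ideal.span_le.2 (by
    rintro _ ⟨x, hx, rfl⟩
    exact Ideal.pow_mem_of_mem _ (hPmin.1.2 hx) 2 two_pos)
  -- `P` is minimal over `𝔟` too, so that `𝔟` has Artinian quotient locally at `P`
  have hPb : P ∈ 𝔟.minimalPrimes := by
    refine ⟨⟨hP, hbP⟩, fun Q ⟨hQ, hbQ⟩ hQP => hPmin.2 ⟨hQ, fun x hx => ?_⟩ hQP⟩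
    exact hQ.mem_of_pow_mem 2 (hbQ (Ideal.subset_span ⟨x, hx, rfl⟩))
  have hbC : ∀ k, 𝔟 * C n ≤ C (n + k) := by
    intro k
    rw [Ideal.mul_le]
    intro r hr z hz
    suffices 𝔟 ≤ (C (n + k)).colon (C n : Set S) from Submodule.mem_colon.1 (this hr) z hz
    refine Ideal.span_le.2 ?_
    rintro _ ⟨x, hx, rfl⟩
    exact Submodule.mem_colon.2 fun z hz =>
      sq_mul_mem_cartierIter hp ((hmult n x).1 hx) k hz
  let A := Localization.AtPrime P
  have : IsNoetherianRing A := IsLocalization.isNoetherianRing P.primeCompl _ inferInstance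
  have hart : IsArtinianRing (A ⧸ 𝔟.map (algebraMap S A)) := by
    refine quotient_artinian_of_mem_minimalPrimes_of_isLocalRing _ ?_
    rw [IsLocalization.minimalPrimes_map P.primeCompl, Set.mem_preimage,
      Localization.AtPrime.under_maximalIdeal]
    exact hPb
  let N : Ideal A := (C n).map (algebraMap S A)
  obtain ⟨k, hk⟩ := exists_eq_succ_of_smul_le (N := N) (𝔟.map (algebraMap S A))
    (fun k => Submodule.comap N.subtype ((C (n + k)).map (algebraMap S A)))
    (fun i j hij => Submodule.comap_mono (Ideal.map_mono (cartierIter_antitone (by omega))))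
    (fun k => by
      rw [← Submodule.map_le_iff_le_comap, Submodule.map_smul'', Submodule.map_top,
        Submodule.range_subtype, smul_eq_mul, ← Ideal.map_mul]
      exact Ideal.map_mono (hbC k))
  have hmap : (C (n + k)).map (algebraMap S A) ≤ (C (n + k + 1)).map (algebraMap S A) := by
    intro y hy
    have hyN : y ∈ N := Ideal.map_mono (cartierIter_antitone (by omega)) hy
    have h1 : (⟨y, hyN⟩ : N) ∈ Submodule.comap N.subtype ((C (n + k)).map (algebraMap S A)) := hy
    rw [hk] at h1
    exact h1
  obtain ⟨s, hsP, hs⟩ := exists_notMem_forall_mul_mem (IsNoetherian.noetherian _) hmap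
  have h2 : s ∈ mult (n + k) := (hmult _ _).2 hs
  rw [← hn (n + k) (Nat.le_add_right _ _)] at h2
  exact hsP (hPmin.1.2 h2)

end Cartier

/-! ### Maps linear over `q`-th powers -/

section PowLinear

variable {S : Type*} [CommRing S] {p : ℕ}

theorem pow_succ_sub_one_eq {p : ℕ} (hp : p ≠ 0) (e : ℕ) :
    p ^ (e + 1) - 1 = (p - 1) * p ^ e + (p ^ e - 1) := by
  have h1 : 1 ≤ p ^ e := Nat.one_le_pow _ _ (Nat.pos_of_ne_zero hp)
  obtain ⟨k, rfl⟩ := Nat.exists_eq_succ_of_ne_zero hp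
  rw [Nat.succ_sub_one, pow_succ', Nat.succ_mul]
  omega

theorem iterateFrobenius_succ_eq_comp (S : Type*) [CommRing S] (p : ℕ) [ExpChar S p] (e : ℕ) :
    iterateFrobenius S p (e + 1) = (iterateFrobenius S p e).comp (frobenius S p) := by
  ext x
  simp [iterateFrobenius_def, frobenius_def, ← pow_mul, pow_succ']

/-- The ideal of all values at `x` of the additive maps `θ : S → S` that are `q⁻¹`-linear, in the
sense that `θ (a ^ q * y) = a * θ y`. -/
def rootIdeal (q : ℕ) (x : S) : Ideal S where
  carrier := {z | ∃ θ : S →+ S, (∀ a y, θ (a ^ q * y) = a * θ y) ∧ θ x = z}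
  zero_mem' := ⟨0, by simp, rfl⟩
  add_mem' := by
    rintro _ _ ⟨θ, hθ, rfl⟩ ⟨η, hη, rfl⟩
    exact ⟨θ + η, fun a y => by simp [hθ, hη, mul_add], rfl⟩
  smul_mem' := by
    rintro c _ ⟨θ, hθ, rfl⟩
    exact ⟨(AddMonoidHom.mulLeft c).comp θ, fun a y => by simp [hθ, mul_left_comm], rfl⟩

/-- The ideal of all values at `x` of the additive maps `D : S → S` that are linear over the
subring of `q`-th powers. -/
def powLinearIdeal (q : ℕ) (x : S) : Ideal S where
  carrier := {z | ∃ D : S →+ S, (∀ a y, D (a ^ q * y) = a ^ q * D y) ∧ D x = z}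
  zero_mem' := ⟨0, by simp, rfl⟩
  add_mem' := by
    rintro _ _ ⟨θ, hθ, rfl⟩ ⟨η, hη, rfl⟩
    exact ⟨θ + η, fun a y => by simp [hθ, hη, mul_add], rfl⟩
  smul_mem' := by
    rintro c _ ⟨θ, hθ, rfl⟩
    exact ⟨(AddMonoidHom.mulLeft c).comp θ, fun a y => by simp [hθ, mul_left_comm], rfl⟩

theorem map_rootIdeal_le [ExpChar S p] (e : ℕ) (x : S) :
    (rootIdeal (p ^ e) x).map (iterateFrobenius S p e) ≤ powLinearIdeal (p ^ e) x := by
  rw [Ideal.map_le_iff_le_comap]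
  rintro _ ⟨θ, hθ, rfl⟩
  refine ⟨(iterateFrobenius S p e : S →+ S).comp θ, fun a y => ?_, rfl⟩
  simp [hθ, iterateFrobenius_def, mul_pow]

theorem cartierIter_le_rootIdeal (hp : p ≠ 0) (f : S) (e : ℕ) :
    cartierIter p (f ^ (p - 1)) e ≤ rootIdeal (p ^ e) (f ^ (p ^ e - 1)) := by
  induction e with
  | zero => exact fun z _ => ⟨AddMonoidHom.mulLeft z, fun a y => by simp [mul_left_comm], by simp⟩
  | succ e ih =>
    refine cartierImage_le fun φ hφ y hy => ?_
    obtain ⟨θ, hθ, rfl⟩ := ih hy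
    refine ⟨φ.comp θ, fun a y => ?_, ?_⟩
    · rw [AddMonoidHom.comp_apply, AddMonoidHom.comp_apply, pow_succ', pow_mul, hθ, hφ]
    · rw [pow_succ_sub_one_eq hp, pow_add, pow_mul, AddMonoidHom.comp_apply, hθ]

/-- When Frobenius has a finite dual basis, `f ^ (p ^ e - 1)` lies in the Frobenius power of the
`e`-th ideal of the chain attached to `f ^ (p - 1)`: expand `f ^ (p - 1) * y`, for `y` in one ideal
of the chain, in the dual basis. -/
theorem pow_mem_map_cartierIter [ExpChar S p] (hp : p ≠ 0) {n : ℕ} {b : Fin n → S}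
    {c : Fin n → (S →+ S)} (hc : ∀ i a y, c i (a ^ p * y) = a * c i y)
    (hb : ∀ y, ∑ i, c i y ^ p * b i = y) (f : S) (e : ℕ) : f ^ (p ^ e - 1) ∈
      (cartierIter p (f ^ (p - 1)) e).map (iterateFrobenius S p e) := by
  set C := cartierIter p (f ^ (p - 1)) with hC
  induction e with
  | zero =>
    rw [show C 0 = ⊤ from rfl, Ideal.map_top]
    exact Submodule.mem_top
  | succ e ih =>
    have hstep : ∀ y ∈ C e, f ^ (p - 1) * y ∈ (C (e + 1)).map (frobenius S p) := by
      intro y hy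
      rw [← hb (f ^ (p - 1) * y)]
      refine Ideal.sum_mem _ fun i _ => Ideal.mul_mem_right _ _ ?_
      exact Ideal.mem_map_of_mem (frobenius S p) (mem_cartierImage (c i) (hc i) hy)
    rw [pow_succ_sub_one_eq hp, pow_add, pow_mul, iterateFrobenius_succ_eq_comp, ← Ideal.map_map]
    suffices (C e).map (iterateFrobenius S p e) ≤ Submodule.comap
        (LinearMap.mulLeft S ((f ^ (p - 1)) ^ p ^ e))
        (((C (e + 1)).map (frobenius S p)).map (iterateFrobenius S p e)) from this ih
    refine Ideal.span_le.2 ?_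
    rintro _ ⟨y, hy, rfl⟩
    have := Ideal.mem_map_of_mem (iterateFrobenius S p e) (hstep y hy)
    rwa [map_mul, iterateFrobenius_def] at this

/-- In an `F`-finite regular domain, some map linear over `q`-th powers, `q = p ^ (e + 1)`, carries
`f ^ (q - 1)` to `f ^ (q - p)`; extended to the localization it carries `1 / f` to `1 / f ^ p`.
Here `e` is such that `cartierIter p (f ^ (p - 1))` agrees at `e` and `e + 1`. -/
theorem exists_powLinear_apply_eq [Fact p.Prime] [IsDomain S] [ExpChar S p] [IsRegularRing S]
    (hS : IsFFinite p S) (f : S) :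
    ∃ (e : ℕ) (D : S →+ S), (∀ a y, D (a ^ p ^ (e + 1) * y) = a ^ p ^ (e + 1) * D y) ∧
      D (f ^ (p ^ (e + 1) - 1)) = f ^ (p ^ (e + 1) - p) := by
  have hp : p.Prime := Fact.out
  obtain ⟨n, b, c, hc, hb⟩ := exists_dual_basis (frobenius S p) hS (flat_frobenius p S hS)
  obtain ⟨e, he⟩ := exists_cartierIter_eq_succ hp.two_le (f ^ (p - 1))
  refine ⟨e, ?_⟩
  -- `f ^ (p ^ (e + 1) - p)` is the Frobenius image of `f ^ (p ^ e - 1)`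
  have h := Ideal.mem_map_of_mem (frobenius S p)
    (pow_mem_map_cartierIter hp.ne_zero hc hb f e)
  have hiter : (frobenius S p).comp (iterateFrobenius S p e) = iterateFrobenius S p (e + 1) := by
    ext x; simp [iterateFrobenius_def, frobenius_def, ← pow_mul, pow_succ]
  rw [Ideal.map_map, hiter, he, frobenius_def, ← pow_mul, Nat.sub_mul, ← pow_succ, one_mul] at h
  exact map_rootIdeal_le _ _ (Ideal.map_mono (cartierIter_le_rootIdeal hp.ne_zero f (e + 1)) h)

end PowLinear

/-! ### Maps linear over `q`-th powers as differential operators -/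

section DiffOp
open scoped TensorProduct

variable {S : Type*} [CommRing S]

/-- The map `S ⊗ S → S`, `a ⊗ b ↦ a * D b`, which extends an additive map `D` linearly over the
left factor. Multiplication by `1 ⊗ r - r ⊗ 1` before it corresponds to the commutator with `r`. -/
noncomputable def tensorLift (D : S →ₗ[ℤ] S) : S ⊗[ℤ] S →ₗ[ℤ] S :=
  LinearMap.mul' ℤ S ∘ₗ TensorProduct.map LinearMap.id D

theorem tensorLift_tmul (D : S →ₗ[ℤ] S) (a b : S) : tensorLift D (a ⊗ₜ b) = a * D b := rfl

/-- The ideal of all `z` such that `tensorLift D` vanishes on the multiples of `z`. -/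
def tensorAnnihilator (D : S →ₗ[ℤ] S) : Ideal (S ⊗[ℤ] S) where
  carrier := {z | ∀ w, tensorLift D (w * z) = 0}
  zero_mem' := by simp
  add_mem' := fun hx hy w => by rw [mul_add, map_add, hx, hy, add_zero]
  smul_mem' := fun c x hx w => by rw [smul_eq_mul, ← mul_assoc]; exact hx _

/-- The elements `1 ⊗ r - r ⊗ 1` generate the ideal of the diagonal; if its `(n + 1)`-st power
annihilates `D`, then all `(n + 1)`-fold commutators of `D` vanish. -/
theorem isDiffOp_of_pow_le_tensorAnnihilator (n : ℕ) (D : S →ₗ[ℤ] S)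
    (h : Ideal.span (Set.range fun r : S => (1 : S) ⊗ₜ[ℤ] r - r ⊗ₜ[ℤ] (1 : S)) ^ (n + 1) ≤
      tensorAnnihilator D) : IsDiffOp S n D := by
  have hcomm : ∀ (D : S →ₗ[ℤ] S) (r : S) (z : S ⊗[ℤ] S),
      tensorLift (commR D r) z = tensorLift D (z * (1 ⊗ₜ r - r ⊗ₜ 1)) := by
    intro D r z
    induction z with
    | zero => simp
    | tmul x y =>
      simp only [mul_sub, map_sub, Algebra.TensorProduct.tmul_mul_tmul, tensorLift_tmul,
        commR_apply, smul_eq_mul, mul_one]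
      rw [mul_comm y r, mul_assoc]
    | add x y hx hy => rw [add_mul, map_add, map_add, hx, hy]
  induction n generalizing D with
  | zero =>
    intro r m
    rw [zero_add, Submodule.pow_one] at h
    have h1 := h (Ideal.subset_span ⟨r, rfl⟩) (1 ⊗ₜ m)
    rw [← hcomm, tensorLift_tmul, one_mul, commR_apply, sub_eq_zero] at h1
    exact h1
  | succ n ih =>
    intro r
    refine ih _ fun z hz w => ?_
    rw [hcomm, mul_assoc]
    refine h ?_ w
    rw [Submodule.pow_succ]
    exact Ideal.mul_mem_mul hz (Ideal.subset_span ⟨r, rfl⟩)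

/-- Over an `F`-finite ring, additive maps that are linear over `p ^ e`-th powers are differential
operators: modulo the annihilator of `D` the ideal of the diagonal is generated by finitely many
elements `1 ⊗ b - b ⊗ 1`, each of which has vanishing `p ^ e`-th power. -/
theorem exists_isDiffOp_of_powLinear (p : ℕ) [Fact p.Prime] [CharP S p] (hS : IsFFinite p S)
    (e : ℕ) (D : S →ₗ[ℤ] S) (hD : ∀ a y, D (a ^ p ^ e * y) = a ^ p ^ e * D y) :
    ∃ n, IsDiffOp S n D := by
  have hfin : (iterateFrobenius S p e).Finite := by
    clear hD
    induction e with
    | zero => rw [iterateFrobenius_zero]; exact RingHom.Finite.id S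
    | succ e ih =>
      rw [iterateFrobenius_succ_eq_comp]
      exact ih.comp hS
  obtain ⟨n, b, hb⟩ := (finite_iff_exists_sum _).1 hfin
  let δ : S → S ⊗[ℤ] S := fun r => 1 ⊗ₜ r - r ⊗ₜ 1
  have hδmul : ∀ r s, δ (r * s) = (1 ⊗ₜ r) * δ s + (s ⊗ₜ 1) * δ r := by
    intro r s
    simp only [δ, mul_sub, Algebra.TensorProduct.tmul_mul_tmul, mul_one, one_mul, mul_comm s r]
    abel
  have hδpow : ∀ r, δ r ^ p ^ e = δ (r ^ p ^ e) := by
    intro r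
    have : CharP (S ⊗[ℤ] S) p := by
      refine charP_of_injective_algebraMap (R := S) ?_ p
      have hleft : Function.LeftInverse (Algebra.TensorProduct.lmul' (S := S) ℤ)
          (algebraMap S (S ⊗[ℤ] S)) := fun x => by simp
      exact hleft.injective
    simp only [δ]
    rw [sub_pow_char_pow, Algebra.TensorProduct.tmul_pow, Algebra.TensorProduct.tmul_pow, one_pow]
  have hδD : ∀ r, δ (r ^ p ^ e) ∈ tensorAnnihilator D := by
    intro r w
    induction w with
    | zero => simp
    | tmul x y =>
      simp only [δ, mul_sub, map_sub, Algebra.TensorProduct.tmul_mul_tmul, tensorLift_tmul, mul_one]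
      rw [mul_comm y, hD]; ring
    | add x y hx hy => rw [add_mul, map_add, hx, hy, add_zero]
  let I : Ideal (S ⊗[ℤ] S) := Ideal.span (Set.range fun i => δ (b i))
  have hle : Ideal.span (Set.range δ) ≤ I ⊔ tensorAnnihilator D := by
    refine Ideal.span_le.2 ?_
    rintro _ ⟨r, rfl⟩
    obtain ⟨a, rfl⟩ := hb r
    have hsum : δ (∑ i, iterateFrobenius S p e (a i) * b i) =
        ∑ i, δ (iterateFrobenius S p e (a i) * b i) := by
      simp only [δ, TensorProduct.tmul_sum, TensorProduct.sum_tmul, Finset.sum_sub_distrib]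
    rw [hsum]
    refine Ideal.sum_mem _ fun i _ => ?_
    rw [hδmul, iterateFrobenius_def]
    exact add_mem (Ideal.mul_mem_left _ _ (Ideal.mem_sup_left (Ideal.subset_span ⟨i, rfl⟩)))
      (Ideal.mul_mem_left _ _ (Ideal.mem_sup_right (hδD _)))
  have hrad : I ≤ (tensorAnnihilator D).radical := by
    refine Ideal.span_le.2 ?_
    rintro _ ⟨i, rfl⟩
    exact ⟨p ^ e, by rw [hδpow]; exact hδD _⟩
  obtain ⟨k, hk⟩ := Ideal.exists_pow_le_of_le_radical_of_fg hrad
    (Submodule.fg_span (Set.finite_range _))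
  refine ⟨k, isDiffOp_of_pow_le_tensorAnnihilator k D ?_⟩
  refine (Ideal.pow_right_mono hle (k + 1)).trans (Ideal.sup_pow_add_le_pow_sup_pow.trans ?_)
  exact sup_le hk (pow_one _).le

/-- A differential operator `D` of an `R`-algebra `S` and an `R`-linear map `β : S → R` yield the
differential operator `β ∘ D` of `R`, since the commutator with `r` passes through `β`. -/
theorem IsDiffOp.comp_algebraMap {R : Type*} [CommRing R] [Algebra R S] (β : S →ₗ[R] R) {n : ℕ}
    {D : S →ₗ[ℤ] S} (hD : IsDiffOp S n D) :
    IsDiffOp R n (β.restrictScalars ℤ ∘ₗ D ∘ₗ (Algebra.linearMap R S).restrictScalars ℤ) := by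
  induction n generalizing D with
  | zero =>
    intro r m
    have h := hD (algebraMap R S r) (algebraMap R S m)
    simp only [smul_eq_mul] at h
    simp only [LinearMap.comp_apply, LinearMap.restrictScalars_apply, Algebra.linearMap_apply,
      smul_eq_mul, map_mul]
    rw [h, ← Algebra.smul_def, map_smul, smul_eq_mul]
  | succ n ih =>
    intro r
    convert! ih (hD (algebraMap R S r)) using 1
    ext m
    simp [← Algebra.smul_def]

end DiffOp

/-! ### Action on the localization -/

section Localization

variable {R : Type*} [CommRing R]

/-- An operator commuting with `g` acts on `v / g` through the numerator. -/
theorem diffOp_smul_mk_of_comm {W : Submonoid R} (D : diffOp R) (g : W)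
    (hD : ∀ y, (D : Module.End ℤ R) (g * y) = g * (D : Module.End ℤ R) y) (v : R) :
    D • (Localization.mk v g : Localization W) = Localization.mk ((D : Module.End ℤ R) v) g := by
  have h0 : commOp D (g : R) = 0 := by
    ext y
    simp [commOp, hD]
  rw [diffOp_smul_mk, h0, zero_smul, sub_zero, ← Localization.mk_one_eq_algebraMap,
    Localization.mk_mul, one_mul, mul_one]

/-- Multiplication by `r`, as an element of `D_R`. -/
def mulOp (r : R) : diffOp R := ⟨mulBy R r, 0, fun s m => by simp [mul_left_comm]⟩

theorem mulOp_smul_mk {W : Submonoid R} (r v : R) (g : W) :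
    mulOp r • (Localization.mk v g : Localization W) = Localization.mk (r * v) g :=
  diffOp_smul_order_zero _ (fun s m => by simp [mulOp, mul_left_comm]) v g

end Localization

/-- The map of `exists_powLinear_apply_eq`, restricted to a direct summand `R` of `S`. -/
theorem exists_diffOp_apply_eq {p : ℕ} [Fact p.Prime] {R S : Type*} [CommRing R] [CommRing S]
    [IsDomain S] [CharP S p] [IsRegularRing S] (hS : IsFFinite p S) [Algebra R S]
    (hRS : IsDirectSummand R S) (f : R) :
    ∃ (q : ℕ) (D : diffOp R), p ≤ q ∧
      (∀ y, (D : Module.End ℤ R) (f ^ q * y) = f ^ q * (D : Module.End ℤ R) y) ∧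
      (D : Module.End ℤ R) (f ^ (q - 1)) = f ^ (q - p) := by
  obtain ⟨β, hβ⟩ := hRS
  obtain ⟨e, D, hD, hDf⟩ := exists_powLinear_apply_eq hS (algebraMap R S f)
  obtain ⟨n, hn⟩ := exists_isDiffOp_of_powLinear p hS (e + 1) D.toIntLinearMap hD
  refine ⟨p ^ (e + 1), ⟨_, n, hn.comp_algebraMap β⟩, ?_, fun y => ?_, ?_⟩
  · exact Nat.le_self_pow (Nat.succ_ne_zero e) p
  · change β (D (algebraMap R S (f ^ p ^ (e + 1) * y))) =
      f ^ p ^ (e + 1) * β (D (algebraMap R S y))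
    rw [map_mul, map_pow, hD, ← map_pow, ← Algebra.smul_def, map_smul, smul_eq_mul]
  · change β (D (algebraMap R S (f ^ (p ^ (e + 1) - 1)))) = _
    rw [map_pow, hDf, ← map_pow, hβ]

end DSummand

theorem theorem4p4 (p : ℕ) [Fact p.Prime] {R S : Type*} [CommRing R] [CommRing S] [IsDomain S]
    [CharP S p] [IsRegularRing S] (hS : DSummand.IsFFinite p S)
    [IsNoetherianRing R] [Algebra R S] (hRS : DSummand.IsDirectSummand R S) (f : R) :
    Submodule.span (DSummand.diffOp R)
      {(Localization.mk 1 ⟨f, Submonoid.mem_powers f⟩ : Localization.Away f)} = ⊤ := by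
  have hp : p.Prime := Fact.out
  let g : ℕ → Submonoid.powers f := fun n => ⟨f ^ n, n, rfl⟩
  have hcancel : ∀ a b : ℕ, (Localization.mk (f ^ a) (g (a + b)) : Localization.Away f) =
      Localization.mk 1 (g b) := by
    intro a b
    rw [Localization.mk_eq_mk_iff, Localization.r_iff_exists]
    exact ⟨1, by simp [g, pow_add, mul_comm]⟩
  set M := Submodule.span (DSummand.diffOp R)
    {(Localization.mk 1 ⟨f, Submonoid.mem_powers f⟩ : Localization.Away f)} with hM
  have hpow : ∀ k, (Localization.mk 1 (g (p ^ k)) : Localization.Away f) ∈ M := by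
    intro k
    induction k with
    | zero =>
      have : g (p ^ 0) = ⟨f, Submonoid.mem_powers f⟩ := Subtype.ext (by simp [g])
      rw [this]
      exact Submodule.mem_span_singleton_self _
    | succ k ih =>
      obtain ⟨q, D, hpq, hDq, hDf⟩ := DSummand.exists_diffOp_apply_eq (p := p) hS hRS (f ^ p ^ k)
      have h1 := M.smul_mem D ih
      -- `1 / F = F ^ (q - 1) / F ^ q` for `F = f ^ p ^ k`, and `D` commutes with `F ^ q`
      have h2 : (Localization.mk 1 (g (p ^ k)) : Localization.Away f) =
          Localization.mk ((f ^ p ^ k) ^ (q - 1)) (g (p ^ k * q)) := by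
        rw [← hcancel (p ^ k * (q - 1)), pow_mul, ← mul_add_one, Nat.sub_add_cancel]
        exact hp.one_le.trans hpq
      have h3 : p ^ k * q = p ^ k * (q - p) + p ^ (k + 1) := by
        rw [pow_succ, ← mul_add, Nat.sub_add_cancel hpq]
      rw [h2, DSummand.diffOp_smul_mk_of_comm D (g (p ^ k * q))
        (by simpa [g, pow_mul] using hDq), hDf, ← pow_mul, h3, hcancel] at h1
      exact h1
  rw [eq_top_iff]
  intro y _
  induction y using Localization.induction_on with
  | H z =>
    obtain ⟨v, ⟨_, n, rfl⟩⟩ := z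
    have hn : n ≤ p ^ n := (Nat.lt_pow_self hp.one_lt).le
    have h := M.smul_mem (DSummand.mulOp (v * f ^ (p ^ n - n))) (hpow n)
    rw [DSummand.mulOp_smul_mk, mul_one] at h
    convert! h using 1
    rw [Localization.mk_eq_mk_iff, Localization.r_iff_exists]
    refine ⟨1, ?_⟩
    have : f ^ p ^ n = f ^ (p ^ n - n) * f ^ n := by rw [← pow_add, Nat.sub_add_cancel hn]
    simp only [g, OneMemClass.coe_one, one_mul, this]
    ring
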